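/- **Definitions.** An integral binary quadratic form (IBQF) is $q(x,y)=ax^2+bxy+cy^2$ with $a,b,c\in\mathbb Z$; its discriminant is $b^2-4ac$, its content is $\gcd(a,b,c)$, it is primitive if its content is $1$, $[q]$ is its $\mathrm{SL}_2(\mathbb Z)$-equivalence class, and $\overline{[q]}=[q(-x,y)]$. If $s_1,s_2$ are classes of the same discriminant with coprime contents, one can choose $a_1,a_2,b,c\in\mathbb Z$ with $s_1=[a_1x^2+bxy+a_2cy^2]$ and $s_2=[a_2x^2+bxy+a_1cy^2]$, and the class $s_1*s_2:=[a_1a_2x^2+bxy+cy^2]$ does not depend on the choice (Dirichlet composition). On the primitive classes of discriminant $D\neq 0$ this is Gauss composition; it makes them an abelian group whose neutral element is the class of the principal form ($x^2-\frac D4y^2$ if $D\equiv 0$, and $x^2+xy+\frac{1-D}4y^2$ if $D\equiv 1 \bmod 4$). A plane is a rank-two direct summand $L$ of $M_2(\mathbb Z)\cong\mathbb Z^4$ with an orientation, i.e. a basis up to base change of determinant $1$. For an oriented basis $(v_1,v_2)$ of $L$ let $q_L(x,y)=\det(xv_1+yv_2)$; its class $[q_L]$ depends only on $L$. Write $\overline{v}$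 for the adjugate of $v\in M_2(\mathbb Z)$, and let $\Lambda$ be the lattice of integral traceless $2\times 2$ matrices with even off-diagonal entries. The Klein vectors of $L$ are $$a_1(L)=2v_1\overline{v_2}-\operatorname{tr}(v_1\overline{v_2})I,\qquad a_2(L)=2\overline{v_2}v_1-\operatorname{tr}(\overline{v_2}v_1)I,$$ elements of $\Lambda$ that depend only on $L$. For $A=\begin{pmatrix} b&2a\\-2c&-b\end{pmatrix}\in\Lambda$ let $q_A=ax^2+bxy+cy^2$; the content of $A$ is that of $q_A$, and $A$ is primitive if $q_A$ is. Two elements of $\Lambda$ are pair-primitive if there is no prime $p$ such that both lie in $p\Lambda$. **Theorem.** Let $L\subset M_2(\mathbb Z)$ be a plane with $\operatorname{disc}(q_L)\ne 0$, with Klein vectors $a_1=a_1(L)$, $a_2=a_2(L)$. Then $a_1,a_2$ are pair-primitive, the Dirichlet composition $\overline{[q_{a_1}]}*[q_{a_2}]$ is defined, and $$[q_L]=\overline{[q_{a_1}]}*[q_{a_2}].$$ The content of $q_L$ is the product of the contents of $a_1$ and $a_2$. In particular, if $a_1$ and $a_2$ are primitive, then $q_L$ is primitive and $[q_L]=[q_{a_1}]^{-1}*[q_{a_2}]$,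 the inverse being taken in the group of primitive classes of discriminant $\operatorname{disc}(q_L)$. -/

import Mathlib

/-- An integral binary quadratic form `a x ^ 2 + b x y + c y ^ 2`. -/
@[ext] structure IBQF where
  a : ℤ
  b : ℤ
  c : ℤ

namespace IBQF

/-- The value `q(x, y)`. -/
def eval (q : IBQF) (x y : ℤ) : ℤ := q.a * x ^ 2 + q.b * x * y + q.c * y ^ 2

/-- The discriminant `b ^ 2 - 4 a c`. -/
def disc (q : IBQF) : ℤ := q.b ^ 2 - 4 * q.a * q.c

/-- The content, that is, the greatest common divisor of the three coefficients. -/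
def content (q : IBQF) : ℕ := Nat.gcd q.a.natAbs (Nat.gcd q.b.natAbs q.c.natAbs)

/-- The orientation reversal `q(-x, y)`. -/
def bar (q : IBQF) : IBQF := ⟨q.a, -q.b, q.c⟩

theorem eval_bar (q : IBQF) (x y : ℤ) : q.bar.eval x y = q.eval (-x) y := by
  simp only [bar, eval]; ring

/-- The composite `q ∘ g` of a form with an integral two by two matrix. -/
def comp (q : IBQF) (g : Matrix (Fin 2) (Fin 2) ℤ) : IBQF :=
  ⟨q.eval (g 0 0) (g 1 0),
   2 * q.a * g 0 0 * g 0 1 + q.b * (g 0 0 * g 1 1 + g 0 1 * g 1 0) + 2 * q.c * g 1 0 * g 1 1,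
   q.eval (g 0 1) (g 1 1)⟩

theorem eval_comp (q : IBQF) (g : Matrix (Fin 2) (Fin 2) ℤ) (x y : ℤ) :
    (q.comp g).eval x y = q.eval (g 0 0 * x + g 0 1 * y) (g 1 0 * x + g 1 1 * y) := by
  simp only [comp, eval]; ring

theorem comp_one (q : IBQF) : q.comp 1 = q := by
  ext <;> simp [comp, eval]

theorem comp_mul (q : IBQF) (g h : Matrix (Fin 2) (Fin 2) ℤ) :
    q.comp (g * h) = (q.comp g).comp h := by
  ext <;> simp only [comp, eval, Matrix.mul_apply, Fin.sum_univ_two] <;> ring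

/-- `SL₂(ℤ)`-equivalence of integral binary quadratic forms. -/
def slSetoid : Setoid IBQF where
  r q q' := ∃ g : Matrix (Fin 2) (Fin 2) ℤ, g.det = 1 ∧ q' = q.comp g
  iseqv :=
    { refl := fun q => ⟨1, Matrix.det_one, (comp_one q).symm⟩
      symm := by
        rintro q _ ⟨g, hg, rfl⟩
        refine ⟨g.adjugate, ?_, ?_⟩
        · rw [Matrix.det_adjugate, hg, one_pow]
        · rw [← comp_mul, Matrix.mul_adjugate, hg, one_smul, comp_one]
      trans := by
        rintro q _ _ ⟨g, hg, rfl⟩ ⟨h, hh, rfl⟩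
        exact ⟨g * h, by rw [Matrix.det_mul, hg, hh, one_mul], by rw [comp_mul]⟩ }

theorem disc_comp (q : IBQF) (g : Matrix (Fin 2) (Fin 2) ℤ) (hg : g.det = 1) :
    (q.comp g).disc = q.disc := by
  rw [Matrix.det_fin_two] at hg
  have : (q.comp g).disc = q.disc * (g 0 0 * g 1 1 - g 0 1 * g 1 0) ^ 2 := by
    simp only [comp, disc, eval]; ring
  rw [this, hg]; ring

theorem content_dvd_content_comp (q : IBQF) (g : Matrix (Fin 2) (Fin 2) ℤ) :
    q.content ∣ (q.comp g).content := by
  have ha : (q.content : ℤ) ∣ q.a := Int.natCast_dvd.2 (Nat.gcd_dvd_left _ _)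
  have hb : (q.content : ℤ) ∣ q.b :=
    Int.natCast_dvd.2 ((Nat.gcd_dvd_right _ _).trans (Nat.gcd_dvd_left _ _))
  have hc : (q.content : ℤ) ∣ q.c :=
    Int.natCast_dvd.2 ((Nat.gcd_dvd_right _ _).trans (Nat.gcd_dvd_right _ _))
  have he : ∀ x y, (q.content : ℤ) ∣ q.eval x y := fun x y =>
    dvd_add (dvd_add (ha.mul_right _) ((hb.mul_right _).mul_right _)) (hc.mul_right _)
  refine Nat.dvd_gcd (Int.natCast_dvd.1 (he _ _))
    (Nat.dvd_gcd (Int.natCast_dvd.1 ?_) (Int.natCast_dvd.1 (he _ _)))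
  exact dvd_add (dvd_add (((ha.mul_left 2).mul_right _).mul_right _) (hb.mul_right _))
    (((hc.mul_left 2).mul_right _).mul_right _)

theorem content_comp (q : IBQF) (g : Matrix (Fin 2) (Fin 2) ℤ) (hg : g.det = 1) :
    (q.comp g).content = q.content := by
  refine Nat.dvd_antisymm ?_ (content_dvd_content_comp q g)
  have h := content_dvd_content_comp (q.comp g) g.adjugate
  rwa [← comp_mul, Matrix.mul_adjugate, hg, one_smul, comp_one] at h

/-- The principal form of discriminant `D`, for `D` congruent to `0` or `1` modulo `4`: it is
`x ^ 2 - (D / 4) y ^ 2` or `x ^ 2 + x y + ((1 - D) / 4) y ^ 2`. -/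
def principal (D : ℤ) : IBQF := ⟨1, D % 2, (D % 2 - D) / 4⟩

end IBQF

/-- The set of `SL₂(ℤ)`-equivalence classes of integral binary quadratic forms. -/
def FormClass : Type := Quotient IBQF.slSetoid

namespace FormClass

/-- The class `[q]`. -/
def mk (q : IBQF) : FormClass := Quotient.mk IBQF.slSetoid q

/-- The discriminant of a class. -/
def disc (s : FormClass) : ℤ :=
  Quotient.lift IBQF.disc (by rintro q _ ⟨g, hg, rfl⟩; exact (q.disc_comp g hg).symm) s

/-- The content of a class. -/
def content (s : FormClass) : ℕ :=
  Quotient.lift IBQF.content (by rintro q _ ⟨g, hg, rfl⟩; exact (q.content_comp g hg).symm) s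

/-- A class is primitive if its content is one. -/
def IsPrimitive (s : FormClass) : Prop := s.content = 1

/-- The orientation-reversed class `[q(-x, y)]` of `[q]`. -/
def bar (s : FormClass) : FormClass :=
  Quotient.map' (s₁ := IBQF.slSetoid) (s₂ := IBQF.slSetoid) IBQF.bar (by
    rintro q _ ⟨g, hg, rfl⟩
    refine ⟨!![g 0 0, -g 0 1; -g 1 0, g 1 1], ?_, ?_⟩
    · rw [Matrix.det_fin_two] at hg
      rw [Matrix.det_fin_two_of]; linarith
    · ext <;> simp only [IBQF.bar, IBQF.comp, IBQF.eval, Matrix.of_apply, Matrix.cons_val',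
        Matrix.cons_val_zero, Matrix.cons_val_one, Matrix.cons_val_fin_one] <;> ring) s

/-- `s` is the Dirichlet (Gauss) composition `s₁ * s₂`. It is defined for classes of the same
discriminant with coprime contents: choose concordant representatives
`a₁ x ^ 2 + b x y + a₂ c y ^ 2` of `s₁` and `a₂ x ^ 2 + b x y + a₁ c y ^ 2` of `s₂`; the
composition is the class of `a₁ a₂ x ^ 2 + b x y + c y ^ 2`. The predicate says that the
composition is defined, that it does not depend on the concordant representatives, and that it
is `s`. (Concordant representatives have the same discriminant.) -/
structure IsComposition (s₁ s₂ s : FormClass) : Prop where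
  coprime : Nat.Coprime s₁.content s₂.content
  exists_concordant : ∃ a₁ a₂ b c : ℤ, s₁ = mk ⟨a₁, b, a₂ * c⟩ ∧ s₂ = mk ⟨a₂, b, a₁ * c⟩
  eq_of_concordant : ∀ a₁ a₂ b c : ℤ, s₁ = mk ⟨a₁, b, a₂ * c⟩ → s₂ = mk ⟨a₂, b, a₁ * c⟩ →
    s = mk ⟨a₁ * a₂, b, c⟩

/-- `t` is an inverse of the primitive class `s` in the oriented class group of discriminant
`s.disc`: it is primitive, and `t * s` is the neutral element, the class of the principal form. -/
def IsInverse (t s : FormClass) : Prop :=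
  t.IsPrimitive ∧ IsComposition t s (mk (IBQF.principal s.disc))

end FormClass

/-- The Gross lattice: the integral traceless matrices with even off-diagonal entries. -/
def grossLattice : Submodule ℤ (Matrix (Fin 2) (Fin 2) ℤ) where
  carrier := {A | A.trace = 0 ∧ 2 ∣ A 0 1 ∧ 2 ∣ A 1 0}
  zero_mem' := by simp
  add_mem' := by
    rintro A B ⟨hA, hA₁, hA₂⟩ ⟨hB, hB₁, hB₂⟩
    exact ⟨by rw [Matrix.trace_add, hA, hB, add_zero], dvd_add hA₁ hB₁, dvd_add hA₂ hB₂⟩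
  smul_mem' := by
    rintro n A ⟨hA, hA₁, hA₂⟩
    exact ⟨by rw [Matrix.trace_smul, hA, smul_zero], Dvd.dvd.mul_left hA₁ n,
      Dvd.dvd.mul_left hA₂ n⟩

/-- The identification of `q = a x ^ 2 + b x y + c y ^ 2` with the traceless matrix
`A(q) = [b, 2 a; -2 c, -b]`. -/
def grossEquiv : IBQF ≃ grossLattice where
  toFun q := ⟨!![q.b, 2 * q.a; -2 * q.c, -q.b], by
    refine ⟨by simp [Matrix.trace_fin_two], ?_, ?_⟩ <;> simp⟩
  invFun A := ⟨A.1 0 1 / 2, A.1 0 0, -(A.1 1 0 / 2)⟩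
  left_inv q := by
    ext
    · simp
    · simp
    · have h : (-2 * q.c) / 2 = -q.c := by omega
      simpa using (congrArg Neg.neg h)
  right_inv A := by
    obtain ⟨A, hA, ⟨k, hk⟩, ⟨l, hl⟩⟩ := A
    rw [Matrix.trace_fin_two] at hA
    apply Subtype.ext
    ext i j
    fin_cases i <;> fin_cases j <;> simp <;> omega

/-- The binary quadratic form `q_A` of an element `A` of the Gross lattice. -/
def grossForm (A : grossLattice) : IBQF := grossEquiv.symm A

/-- Two elements of the Gross lattice are pair-primitive if no prime divides both of them in the
Gross lattice. -/
def PairPrimitive (A₁ A₂ : grossLattice) : Prop :=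
  ¬ ∃ p : ℕ, p.Prime ∧ ∃ B₁ B₂ : grossLattice, A₁ = (p : ℤ) • B₁ ∧ A₂ = (p : ℤ) • B₂

/-- The form `q(x, y) = det (x v + y w)` for two integral matrices `v`, `w`. -/
def pairForm (v w : Matrix (Fin 2) (Fin 2) ℤ) : IBQF :=
  ⟨v.det, (v * w.adjugate).trace, w.det⟩

theorem pairForm_eval (v w : Matrix (Fin 2) (Fin 2) ℤ) (x y : ℤ) :
    (pairForm v w).eval x y = (x • v + y • w).det := by
  simp [-zsmul_eq_mul, -zsmul_one, pairForm, IBQF.eval, Matrix.det_fin_two, Matrix.adjugate_fin_two, Matrix.trace_fin_two,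
    Matrix.mul_apply, Fin.sum_univ_two]
  ring

/-- For every integral matrix `m`, the matrix `2 m - tr(m) I` lies in the Gross lattice. -/
def grossPart (m : Matrix (Fin 2) (Fin 2) ℤ) : grossLattice :=
  ⟨(2 : ℤ) • m - m.trace • (1 : Matrix (Fin 2) (Fin 2) ℤ), by
    refine ⟨?_, ?_, ?_⟩
    · simp [-zsmul_eq_mul, -zsmul_one, Matrix.trace_fin_two]; ring
    · simp [-zsmul_eq_mul, -zsmul_one]
    · simp [-zsmul_eq_mul, -zsmul_one]⟩

/-- Two bases of a lattice are equivalent if they differ by a base change in `SL₂(ℤ)`. -/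
def orientationSetoid (N : Submodule ℤ (Matrix (Fin 2) (Fin 2) ℤ)) :
    Setoid (Module.Basis (Fin 2) ℤ N) where
  r v w := ∃ g : Matrix (Fin 2) (Fin 2) ℤ, g.det = 1 ∧ ∀ j, w j = ∑ i, g i j • v i
  iseqv :=
    { refl := fun v => ⟨1, Matrix.det_one, fun j => by simp [Matrix.one_apply, -zsmul_eq_mul]⟩
      symm := by
        rintro v w ⟨g, hg, hw⟩
        rw [Matrix.det_fin_two] at hg
        refine ⟨g.adjugate, ?_, fun j => ?_⟩
        · rw [Matrix.det_adjugate, Matrix.det_fin_two, hg, one_pow]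
        · rw [Fin.sum_univ_two, hw, hw, Fin.sum_univ_two, Fin.sum_univ_two,
            Matrix.adjugate_fin_two]
          have e : v j = (g 0 0 * g 1 1 - g 0 1 * g 1 0) • v j := by rw [hg, one_smul]
          rw [e]
          fin_cases j
          · simp only [Fin.zero_eta, Matrix.of_apply, Matrix.cons_val', Matrix.cons_val_zero,
              Matrix.cons_val_one, Matrix.cons_val_fin_one]
            module
          · simp only [Fin.mk_one, Matrix.of_apply, Matrix.cons_val', Matrix.cons_val_zero,
              Matrix.cons_val_one, Matrix.cons_val_fin_one]
            module
      trans := by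
        rintro u v w ⟨g, hg, hv⟩ ⟨h, hh, hw⟩
        refine ⟨g * h, by rw [Matrix.det_mul, hg, hh, one_mul], fun j => ?_⟩
        rw [hw j, Fin.sum_univ_two, Fin.sum_univ_two, hv, hv, Fin.sum_univ_two, Fin.sum_univ_two,
          Matrix.mul_apply, Matrix.mul_apply, Fin.sum_univ_two, Fin.sum_univ_two]
        module }

/-- A plane: an oriented direct summand of rank two of the lattice of integral two by two
matrices. An orientation is a basis up to base change of determinant one. -/
structure OrientedPlane where
  lattice : Submodule ℤ (Matrix (Fin 2) (Fin 2) ℤ)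
  isSummand : ∃ N : Submodule ℤ (Matrix (Fin 2) (Fin 2) ℤ), IsCompl lattice N
  orientation : Quotient (orientationSetoid lattice)

namespace OrientedPlane

variable (L : OrientedPlane)

/-- The class `[q_L]` of the form `q_L(x, y) = det (x v₀ + y v₁)`, for an oriented basis
`(v₀, v₁)` of `L`. -/
noncomputable def formClass : FormClass :=
  Quotient.lift
    (fun v : Module.Basis (Fin 2) ℤ L.lattice => FormClass.mk (pairForm (v 0) (v 1))) (by
      rintro v w ⟨g, hg, hw⟩
      refine Quotient.sound (s := IBQF.slSetoid) ⟨g, hg, ?_⟩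
      rw [hw, hw, Fin.sum_univ_two, Fin.sum_univ_two]
      ext <;>
      simp [-zsmul_eq_mul, -zsmul_one, pairForm, IBQF.comp, IBQF.eval, Matrix.det_fin_two, Matrix.adjugate_fin_two,
        Matrix.trace_fin_two, Matrix.mul_apply, Fin.sum_univ_two] <;> ring) L.orientation

/-- The first Klein vector `a₁(L) = 2 v₀ v̄₁ - tr(v₀ v̄₁) I`, for an oriented basis `(v₀, v₁)`
of `L`, where the bar is the adjugate. -/
noncomputable def klein₁ : grossLattice :=
  Quotient.lift
    (fun v : Module.Basis (Fin 2) ℤ L.lattice =>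
      grossPart ((v 0 : Matrix (Fin 2) (Fin 2) ℤ) * (v 1 : Matrix (Fin 2) (Fin 2) ℤ).adjugate)) (by
      rintro v w ⟨g, h, hw⟩
      rw [Matrix.det_fin_two] at h
      have h0 := hw 0
      have h1 := hw 1
      rw [Fin.sum_univ_two] at h0 h1
      apply Subtype.ext
      have key : ∀ A B : Matrix (Fin 2) (Fin 2) ℤ,
          (grossPart ((g 0 0 • A + g 1 0 • B) * (g 0 1 • A + g 1 1 • B).adjugate)).1 =
          (g 0 0 * g 1 1 - g 0 1 * g 1 0) • (grossPart (A * B.adjugate)).1 := by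
        intro A B
        ext i j
        fin_cases i <;> fin_cases j <;>
        simp [-zsmul_eq_mul, -zsmul_one, grossPart, Matrix.adjugate_fin_two, Matrix.trace_fin_two, Matrix.mul_apply,
          Fin.sum_univ_two] <;> ring
      have := key (v 0) (v 1)
      rw [h, one_smul] at this
      simp only [h0, h1]
      exact this.symm) L.orientation

/-- The second Klein vector `a₂(L) = 2 v̄₁ v₀ - tr(v̄₁ v₀) I`, for an oriented basis `(v₀, v₁)`
of `L`, where the bar is the adjugate. -/
noncomputable def klein₂ : grossLattice :=
  Quotient.lift
    (fun v : Module.Basis (Fin 2) ℤ L.lattice =>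
      grossPart ((v 1 : Matrix (Fin 2) (Fin 2) ℤ).adjugate * (v 0 : Matrix (Fin 2) (Fin 2) ℤ))) (by
      rintro v w ⟨g, h, hw⟩
      rw [Matrix.det_fin_two] at h
      have h0 := hw 0
      have h1 := hw 1
      rw [Fin.sum_univ_two] at h0 h1
      apply Subtype.ext
      have key : ∀ A B : Matrix (Fin 2) (Fin 2) ℤ,
          (grossPart ((g 0 1 • A + g 1 1 • B).adjugate * (g 0 0 • A + g 1 0 • B))).1 =
          (g 0 0 * g 1 1 - g 0 1 * g 1 0) • (grossPart (B.adjugate * A)).1 := by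
        intro A B
        ext i j
        fin_cases i <;> fin_cases j <;>
        simp [-zsmul_eq_mul, -zsmul_one, grossPart, Matrix.adjugate_fin_two, Matrix.trace_fin_two, Matrix.vecMul,
          dotProduct] <;> ring
      have := key (v 0) (v 1)
      rw [h, one_smul] at this
      simp only [h0, h1]
      exact this.symm) L.orientation

/-- The class `[q_{a₁}]` of the form of the first Klein vector. -/
noncomputable def kleinClass₁ : FormClass := FormClass.mk (grossForm L.klein₁)

/-- The class `[q_{a₂}]` of the form of the second Klein vector. -/
noncomputable def kleinClass₂ : FormClass := FormClass.mk (grossForm L.klein₂)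

end OrientedPlane

/-- The form of the first Klein vector of the plane spanned by `v` and `w`. -/
def kleinForm₁ (v w : Matrix (Fin 2) (Fin 2) ℤ) : IBQF := grossForm (grossPart (v * w.adjugate))

/-- The form of the second Klein vector of the plane spanned by `v` and `w`. -/
def kleinForm₂ (v w : Matrix (Fin 2) (Fin 2) ℤ) : IBQF := grossForm (grossPart (w.adjugate * v))

namespace FormClass

theorem mk_eq_mk {q q' : IBQF} :
    mk q = mk q' ↔ ∃ g : Matrix (Fin 2) (Fin 2) ℤ, g.det = 1 ∧ q' = q.comp g :=
  Quotient.eq (r := IBQF.slSetoid)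

theorem bar_mk (q : IBQF) : (mk q).bar = mk q.bar := rfl

theorem disc_mk (q : IBQF) : (mk q).disc = q.disc := rfl

theorem content_mk (q : IBQF) : (mk q).content = q.content := rfl

theorem exists_mk (s : FormClass) : ∃ q, s = mk q := by
  obtain ⟨q, hq⟩ := Quotient.exists_rep s
  exact ⟨q, hq.symm⟩

theorem bar_bar (s : FormClass) : s.bar.bar = s := by
  obtain ⟨q, rfl⟩ := s.exists_mk
  rw [bar_mk, bar_mk]
  congr 1
  ext <;> simp [IBQF.bar]

theorem content_bar (s : FormClass) : s.bar.content = s.content := by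
  obtain ⟨q, rfl⟩ := s.exists_mk
  simp [bar_mk, content_mk, IBQF.bar, IBQF.content]

theorem disc_bar (s : FormClass) : s.bar.disc = s.disc := by
  obtain ⟨q, rfl⟩ := s.exists_mk
  simp [bar_mk, disc_mk, IBQF.bar, IBQF.disc]

theorem mk_swap (a b c : ℤ) : mk ⟨a, b, c⟩ = mk ⟨c, -b, a⟩ := by
  refine mk_eq_mk.2 ⟨!![0, -1; 1, 0], by simp [Matrix.det_fin_two], ?_⟩
  ext <;> simp [IBQF.comp, IBQF.eval]

theorem mk_shift (a b c k : ℤ) :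
    mk ⟨a, b, c⟩ = mk ⟨a, b + 2 * a * k, a * k ^ 2 + b * k + c⟩ := by
  refine mk_eq_mk.2 ⟨!![1, k; 0, 1], by simp [Matrix.det_fin_two], ?_⟩
  ext
  · simp [IBQF.comp, IBQF.eval]
  · simp [IBQF.comp, IBQF.eval]; ring
  · simp [IBQF.comp, IBQF.eval]

end FormClass

theorem grossForm_grossPart (m : Matrix (Fin 2) (Fin 2) ℤ) :
    grossForm (grossPart m) = ⟨m 0 1, m 0 0 - m 1 1, -m 1 0⟩ := by
  ext
  · simp [-zsmul_eq_mul, -zsmul_one, grossForm, grossEquiv, grossPart]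
  · simp [-zsmul_eq_mul, -zsmul_one, grossForm, grossEquiv, grossPart, Matrix.trace_fin_two]; ring
  · simp [-zsmul_eq_mul, -zsmul_one, grossForm, grossEquiv, grossPart]

theorem kleinForm₁_eq (v w : Matrix (Fin 2) (Fin 2) ℤ) : kleinForm₁ v w =
    ⟨-(v 0 0 * w 0 1 - v 0 1 * w 0 0),
      (v 0 0 * w 1 1 - v 1 1 * w 0 0) - (v 0 1 * w 1 0 - v 1 0 * w 0 1),
      -(v 1 0 * w 1 1 - v 1 1 * w 1 0)⟩ := by
  rw [kleinForm₁, grossForm_grossPart]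
  ext <;> simp [Matrix.adjugate_fin_two, Matrix.mul_apply, Fin.sum_univ_two] <;> ring

theorem kleinForm₂_eq (v w : Matrix (Fin 2) (Fin 2) ℤ) : kleinForm₂ v w =
    ⟨v 0 1 * w 1 1 - v 1 1 * w 0 1,
      (v 0 0 * w 1 1 - v 1 1 * w 0 0) + (v 0 1 * w 1 0 - v 1 0 * w 0 1),
      v 0 0 * w 1 0 - v 1 0 * w 0 0⟩ := by
  rw [kleinForm₂, grossForm_grossPart]
  ext <;> simp [Matrix.adjugate_fin_two, Matrix.vecMul, dotProduct, Fin.sum_univ_two] <;> ring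

theorem pairForm_eq (v w : Matrix (Fin 2) (Fin 2) ℤ) : pairForm v w =
    ⟨v 0 0 * v 1 1 - v 0 1 * v 1 0,
      v 0 0 * w 1 1 - v 0 1 * w 1 0 - v 1 0 * w 0 1 + v 1 1 * w 0 0,
      w 0 0 * w 1 1 - w 0 1 * w 1 0⟩ := by
  ext <;> simp [pairForm, Matrix.det_fin_two, Matrix.adjugate_fin_two, Matrix.trace_fin_two,
    Matrix.mul_apply, Fin.sum_univ_two]
  ring

theorem disc_kleinForm₁ (v w : Matrix (Fin 2) (Fin 2) ℤ) :
    (kleinForm₁ v w).disc = (pairForm v w).disc := by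
  rw [kleinForm₁_eq, pairForm_eq]; simp only [IBQF.disc]; ring

theorem disc_kleinForm₂ (v w : Matrix (Fin 2) (Fin 2) ℤ) :
    (kleinForm₂ v w).disc = (pairForm v w).disc := by
  rw [kleinForm₂_eq, pairForm_eq]; simp only [IBQF.disc]; ring

/-- The matrix by which the Gross lattice has to be conjugated to compose forms with `g`. -/
def grossConj (g : Matrix (Fin 2) (Fin 2) ℤ) : Matrix (Fin 2) (Fin 2) ℤ :=
  !![g 0 0, -g 1 0; -g 0 1, g 1 1]

theorem det_grossConj (g : Matrix (Fin 2) (Fin 2) ℤ) : (grossConj g).det = g.det := by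
  simp [grossConj, Matrix.det_fin_two]; ring

theorem grossConj_grossConj (g : Matrix (Fin 2) (Fin 2) ℤ) : grossConj (grossConj g) = g := by
  ext i j
  fin_cases i <;> fin_cases j <;> simp [grossConj]

theorem grossForm_grossPart_conj (g m : Matrix (Fin 2) (Fin 2) ℤ) :
    grossForm (grossPart (grossConj g * m * (grossConj g).adjugate)) =
      (grossForm (grossPart m)).comp g := by
  rw [grossForm_grossPart, grossForm_grossPart]
  ext <;> simp [grossConj, IBQF.comp, IBQF.eval, Matrix.adjugate_fin_two, Matrix.mul_apply,
    Fin.sum_univ_two, Matrix.vecMul, dotProduct] <;> ring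

theorem kleinForm₁_mul_mul {v w g h : Matrix (Fin 2) (Fin 2) ℤ} (hh : h.det = 1) :
    kleinForm₁ (grossConj g * v * h) (grossConj g * w * h) = (kleinForm₁ v w).comp g := by
  rw [kleinForm₁, kleinForm₁, ← grossForm_grossPart_conj]
  congr 2
  rw [Matrix.adjugate_mul_distrib, Matrix.adjugate_mul_distrib]
  have e : h * h.adjugate = 1 := by rw [Matrix.mul_adjugate, hh, one_smul]
  calc _ = grossConj g * v * (h * h.adjugate) * w.adjugate * (grossConj g).adjugate := by
        simp only [Matrix.mul_assoc]
    _ = _ := by rw [e]; simp only [Matrix.mul_assoc, Matrix.one_mul]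

theorem kleinForm₂_mul_mul {v w g h : Matrix (Fin 2) (Fin 2) ℤ} (hg : g.det = 1) :
    kleinForm₂ (g * v * (grossConj h).adjugate) (g * w * (grossConj h).adjugate) =
      (kleinForm₂ v w).comp h := by
  rw [kleinForm₂, kleinForm₂, ← grossForm_grossPart_conj]
  congr 2
  have e : g.adjugate * g = 1 := by rw [Matrix.adjugate_mul, hg, one_smul]
  have e' : (grossConj h).adjugate.adjugate = grossConj h := by
    simp [Matrix.adjugate_fin_two, grossConj]
  rw [Matrix.adjugate_mul_distrib, Matrix.adjugate_mul_distrib, e']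
  calc _ = grossConj h * w.adjugate * (g.adjugate * g) * v * (grossConj h).adjugate := by
        simp only [Matrix.mul_assoc]
    _ = _ := by rw [e]; simp only [Matrix.mul_assoc, Matrix.one_mul]

theorem pairForm_mul_mul {v w g h : Matrix (Fin 2) (Fin 2) ℤ} (hg : g.det = 1) (hh : h.det = 1) :
    pairForm (g * v * h) (g * w * h) = pairForm v w := by
  ext
  · simp [pairForm, hg, hh]
  · have e : h * h.adjugate = 1 := by rw [Matrix.mul_adjugate, hh, one_smul]
    have e' : g.adjugate * g = 1 := by rw [Matrix.adjugate_mul, hg, one_smul]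
    simp only [pairForm, Matrix.adjugate_mul_distrib]
    calc _ = (g * (v * (h * h.adjugate) * w.adjugate * g.adjugate)).trace := by
          simp only [Matrix.mul_assoc]
      _ = (v * w.adjugate * (g.adjugate * g)).trace := by
          rw [e, Matrix.trace_mul_comm]; simp only [Matrix.mul_assoc, Matrix.one_mul]
      _ = _ := by rw [e', Matrix.mul_one]
  · simp [pairForm, hg, hh]

theorem pairForm_baseChange (v w g : Matrix (Fin 2) (Fin 2) ℤ) :
    pairForm (g 0 0 • v + g 1 0 • w) (g 0 1 • v + g 1 1 • w) = (pairForm v w).comp g := by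
  rw [pairForm_eq, pairForm_eq]
  ext <;> simp [-zsmul_eq_mul, IBQF.comp, IBQF.eval] <;> ring

theorem kleinForm₁_baseChange (v w g : Matrix (Fin 2) (Fin 2) ℤ) (hg : g.det = 1) :
    kleinForm₁ (g 0 0 • v + g 1 0 • w) (g 0 1 • v + g 1 1 • w) = kleinForm₁ v w := by
  rw [Matrix.det_fin_two] at hg
  rw [kleinForm₁_eq, kleinForm₁_eq]
  ext <;> simp [-zsmul_eq_mul]
  · linear_combination (-(v 0 0 * w 0 1 - v 0 1 * w 0 0)) * hg
  · linear_combination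
      ((v 0 0 * w 1 1 - v 1 1 * w 0 0) - (v 0 1 * w 1 0 - v 1 0 * w 0 1)) * hg
  · linear_combination (-(v 1 0 * w 1 1 - v 1 1 * w 1 0)) * hg

theorem kleinForm₂_baseChange (v w g : Matrix (Fin 2) (Fin 2) ℤ) (hg : g.det = 1) :
    kleinForm₂ (g 0 0 • v + g 1 0 • w) (g 0 1 • v + g 1 1 • w) = kleinForm₂ v w := by
  rw [Matrix.det_fin_two] at hg
  rw [kleinForm₂_eq, kleinForm₂_eq]
  ext <;> simp [-zsmul_eq_mul]
  · linear_combination (v 0 1 * w 1 1 - v 1 1 * w 0 1) * hg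
  · linear_combination
      ((v 0 0 * w 1 1 - v 1 1 * w 0 0) + (v 0 1 * w 1 0 - v 1 0 * w 0 1)) * hg
  · linear_combination (v 0 0 * w 1 0 - v 1 0 * w 0 0) * hg

/-- A primitive oriented plane is determined by its Plücker coordinates. -/
theorem exists_baseChange_of_minors_eq {ι : Type*} [Fintype ι] (v w v' w' : ι → ℤ)
    (h : ∀ i j, v i * w j - v j * w i = v' i * w' j - v' j * w' i) (c : ι × ι → ℤ)
    (hc : ∑ ij, c ij * (v ij.1 * w ij.2 - v ij.2 * w ij.1) = 1) :
    ∃ g : Matrix (Fin 2) (Fin 2) ℤ, g.det = 1 ∧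
      (∀ i, v' i = g 0 0 * v i + g 1 0 * w i) ∧ ∀ i, w' i = g 0 1 * v i + g 1 1 * w i := by
  have key : ∀ u : ι → ℤ, (∀ i j k, u k * (v i * w j - v j * w i) =
      (u i * w j - u j * w i) * v k + (v i * u j - v j * u i) * w k) → ∀ k,
      u k = (∑ ij, c ij * (u ij.1 * w ij.2 - u ij.2 * w ij.1)) * v k +
        (∑ ij, c ij * (v ij.1 * u ij.2 - v ij.2 * u ij.1)) * w k := by
    intro u hu k
    calc u k = u k * ∑ ij, c ij * (v ij.1 * w ij.2 - v ij.2 * w ij.1) := by rw [hc, mul_one]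
      _ = _ := by
        rw [Finset.mul_sum, Finset.sum_mul, Finset.sum_mul, ← Finset.sum_add_distrib]
        exact Finset.sum_congr rfl fun ij _ => by
          linear_combination c ij * hu ij.1 ij.2 k
  have h₁ := key v' fun i j k => by
    linear_combination v' k * h i j - v' i * h k j + v' j * h k i
  have h₂ := key w' fun i j k => by
    linear_combination w' k * h i j - w' i * h k j + w' j * h k i
  set p := ∑ ij, c ij * (v' ij.1 * w ij.2 - v' ij.2 * w ij.1)
  set q := ∑ ij, c ij * (w' ij.1 * w ij.2 - w' ij.2 * w ij.1)
  set r := ∑ ij, c ij * (v ij.1 * v' ij.2 - v ij.2 * v' ij.1)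
  set s := ∑ ij, c ij * (v ij.1 * w' ij.2 - v ij.2 * w' ij.1)
  refine ⟨!![p, q; r, s], ?_, by simpa using h₁, by simpa using h₂⟩
  rw [Matrix.det_fin_two_of]
  calc p * s - q * r
      = (p * s - q * r) * ∑ ij, c ij * (v ij.1 * w ij.2 - v ij.2 * w ij.1) := by rw [hc, mul_one]
    _ = ∑ ij, c ij * (v ij.1 * w ij.2 - v ij.2 * w ij.1) := by
      rw [Finset.mul_sum]
      refine Finset.sum_congr rfl fun ij _ => ?_
      have e := h ij.1 ij.2
      rw [h₁ ij.1, h₁ ij.2, h₂ ij.1, h₂ ij.2] at e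
      linear_combination (-c ij) * e
    _ = 1 := hc

/-- Integers without a common prime divisor generate the unit ideal. -/
theorem exists_sum_mul_eq_one {ι : Type*} [Fintype ι] (f : ι → ℤ)
    (hf : ∀ p : ℕ, p.Prime → ¬ ∀ i, (p : ℤ) ∣ f i) : ∃ c : ι → ℤ, ∑ i, c i * f i = 1 := by
  rw [← Ideal.mem_span_range_iff_exists_fun, ← Ideal.eq_top_iff_one]
  by_contra hne
  obtain ⟨M, hM, hle⟩ := Ideal.exists_le_maximal _ hne
  obtain ⟨d, rfl⟩ := (IsPrincipalIdealRing.principal M).principal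
  have hd : ∀ i, d ∣ f i := fun i =>
    Ideal.mem_span_singleton.1 (hle (Ideal.subset_span ⟨i, rfl⟩))
  have hu : d.natAbs ≠ 1 := fun hu => hM.ne_top
    (Ideal.span_singleton_eq_top.2 (Int.isUnit_iff_natAbs_eq.2 hu))
  obtain ⟨p, hp, hpd⟩ := Nat.exists_prime_and_dvd hu
  exact hf p hp fun i => (Int.natCast_dvd.2 hpd).trans (hd i)

namespace IBQF

theorem dvd_content_iff (q : IBQF) (n : ℕ) :
    n ∣ q.content ↔ (n : ℤ) ∣ q.a ∧ (n : ℤ) ∣ q.b ∧ (n : ℤ) ∣ q.c := by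
  simp only [content, Nat.dvd_gcd_iff, Int.natCast_dvd]

end IBQF

/-- The class of the form of a plane is determined by the classes of its Klein vectors. -/
theorem mk_pairForm_eq_of_klein {v w v' w' : Matrix (Fin 2) (Fin 2) ℤ}
    (hc : Nat.Coprime (kleinForm₁ v' w').content (kleinForm₂ v' w').content)
    (h₁ : FormClass.mk (kleinForm₁ v w) = FormClass.mk (kleinForm₁ v' w'))
    (h₂ : FormClass.mk (kleinForm₂ v w) = FormClass.mk (kleinForm₂ v' w')) :
    FormClass.mk (pairForm v w) = FormClass.mk (pairForm v' w') := by
  obtain ⟨g, hg, e₁⟩ := FormClass.mk_eq_mk.1 h₁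
  obtain ⟨h, hh, e₂⟩ := FormClass.mk_eq_mk.1 h₂
  have hg' : (grossConj g).det = 1 := by rw [det_grossConj, hg]
  have hh' : (grossConj h).adjugate.det = 1 := by
    rw [Matrix.det_adjugate, det_grossConj, hh, one_pow]
  rw [← kleinForm₁_mul_mul hh'] at e₁
  rw [← kleinForm₂_mul_mul hg'] at e₂
  rw [← pairForm_mul_mul (v := v) (w := w) hg' hh']
  generalize grossConj g * v * (grossConj h).adjugate = V at *
  generalize grossConj g * w * (grossConj h).adjugate = W at *
  have hp : ∀ p : ℕ, p.Prime → ¬ ∀ x : (Fin 2 × Fin 2) × (Fin 2 × Fin 2), (p : ℤ) ∣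
      V x.1.1 x.1.2 * W x.2.1 x.2.2 - V x.2.1 x.2.2 * W x.1.1 x.1.2 := by
    intro p hp hd
    refine Nat.not_coprime_of_dvd_of_dvd hp.one_lt ?_ ?_ hc
    · rw [e₁, IBQF.dvd_content_iff, kleinForm₁_eq]
      exact ⟨(hd ((0, 0), (0, 1))).neg_right,
        (hd ((0, 0), (1, 1))).sub (hd ((0, 1), (1, 0))), (hd ((1, 0), (1, 1))).neg_right⟩
    · rw [e₂, IBQF.dvd_content_iff, kleinForm₂_eq]
      exact ⟨hd ((0, 1), (1, 1)),
        (hd ((0, 0), (1, 1))).add (hd ((0, 1), (1, 0))), hd ((0, 0), (1, 0))⟩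
  obtain ⟨c, hcs⟩ := exists_sum_mul_eq_one _ hp
  rw [kleinForm₁_eq, kleinForm₁_eq, IBQF.mk.injEq] at e₁
  rw [kleinForm₂_eq, kleinForm₂_eq, IBQF.mk.injEq] at e₂
  obtain ⟨a₁, b₁, c₁⟩ := e₁
  obtain ⟨a₂, b₂, c₂⟩ := e₂
  obtain ⟨k, hk, hv, hw⟩ := exists_baseChange_of_minors_eq
    (fun x : Fin 2 × Fin 2 => V x.1 x.2) (fun x => W x.1 x.2)
    (fun x => v' x.1 x.2) (fun x => w' x.1 x.2) (by
      rintro ⟨i, j⟩ ⟨k, l⟩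
      fin_cases i <;> fin_cases j <;> fin_cases k <;> fin_cases l <;> dsimp only [Fin.zero_eta,
        Fin.mk_one] <;> linarith) c hcs
  refine FormClass.mk_eq_mk.2 ⟨k, hk, ?_⟩
  rw [← pairForm_baseChange]
  congr 1
  · ext i j; simpa [-zsmul_eq_mul] using hv (i, j)
  · ext i j; simpa [-zsmul_eq_mul] using hw (i, j)

/-! ### Dirichlet composition -/

theorem pairForm_concordant (a₁ a₂ b c : ℤ) :
    pairForm !![a₁, 0; b, a₂] !![0, -1; c, 0] = ⟨a₁ * a₂, b, c⟩ := by
  rw [pairForm_eq]; ext <;> simp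

theorem kleinForm₁_concordant (a₁ a₂ b c : ℤ) :
    kleinForm₁ !![a₁, 0; b, a₂] !![0, -1; c, 0] = IBQF.bar ⟨a₁, b, a₂ * c⟩ := by
  rw [kleinForm₁_eq]; ext <;> simp [IBQF.bar]

theorem kleinForm₂_concordant (a₁ a₂ b c : ℤ) :
    kleinForm₂ !![a₁, 0; b, a₂] !![0, -1; c, 0] = ⟨a₂, b, a₁ * c⟩ := by
  rw [kleinForm₂_eq]; ext <;> simp

namespace FormClass

theorem mk_pairForm_of_concordant {v w : Matrix (Fin 2) (Fin 2) ℤ}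
    (hc : Nat.Coprime (kleinForm₁ v w).content (kleinForm₂ v w).content) {a₁ a₂ b c : ℤ}
    (h₁ : (mk (kleinForm₁ v w)).bar = mk ⟨a₁, b, a₂ * c⟩)
    (h₂ : mk (kleinForm₂ v w) = mk ⟨a₂, b, a₁ * c⟩) :
    mk (pairForm v w) = mk ⟨a₁ * a₂, b, c⟩ := by
  rw [← pairForm_concordant]
  refine (mk_pairForm_eq_of_klein hc ?_ ?_).symm
  · rw [kleinForm₁_concordant, ← bar_mk, ← h₁, bar_bar]
  · rw [kleinForm₂_concordant, h₂]

theorem isComposition_concordant {a₁ a₂ b c : ℤ}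
    (hc : Nat.Coprime (mk ⟨a₁, b, a₂ * c⟩).content (mk ⟨a₂, b, a₁ * c⟩).content) :
    IsComposition (mk ⟨a₁, b, a₂ * c⟩) (mk ⟨a₂, b, a₁ * c⟩) (mk ⟨a₁ * a₂, b, c⟩) := by
  refine ⟨hc, ⟨a₁, a₂, b, c, rfl, rfl⟩, fun a₁' a₂' b' c' h₁ h₂ => ?_⟩
  rw [← pairForm_concordant a₁]
  refine mk_pairForm_of_concordant ?_ ?_ ?_
  · rw [kleinForm₁_concordant, kleinForm₂_concordant, ← content_mk, ← content_mk, ← bar_mk,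
      content_bar]
    exact hc
  · rw [kleinForm₁_concordant, ← bar_mk, bar_bar, h₁]
  · rw [kleinForm₂_concordant, h₂]

end FormClass

namespace IBQF

theorem exists_eval_not_dvd (q : IBQF) (hq : q.content = 1) (p : ℕ) (hp : p.Prime) :
    ∃ x y : ℕ, ¬ (p : ℤ) ∣ q.eval x y := by
  by_contra! H
  have ha : (p : ℤ) ∣ q.a := by simpa [eval] using H 1 0
  have hc : (p : ℤ) ∣ q.c := by simpa [eval] using H 0 1
  have hb : (p : ℤ) ∣ q.b := by
    have e : q.b = q.eval (1 : ℕ) (1 : ℕ) - q.a - q.c := by simp [eval]; ring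
    rw [e]; exact ((H 1 1).sub ha).sub hc
  have h := (q.dvd_content_iff p).2 ⟨ha, hb, hc⟩
  rw [hq] at h
  exact hp.one_lt.ne' (Nat.dvd_one.1 h)

/-- A primitive form properly represents an integer coprime to a given nonzero integer. -/
theorem exists_isCoprime_eval (q : IBQF) (hq : q.content = 1) (N : ℕ) (hN : N ≠ 0) :
    ∃ x y : ℤ, IsCoprime x y ∧ IsCoprime (q.eval x y) N := by
  obtain ⟨x, y, h⟩ : ∃ x y : ℤ, IsCoprime (q.eval x y) N := by
    choose! X Y hXY using q.exists_eval_not_dvd hq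
    have hne : ∀ p ∈ N.primeFactors, id p ≠ 0 := fun p hp => (Nat.prime_of_mem_primeFactors hp).ne_zero
    have hco : Set.Pairwise (N.primeFactors : Set ℕ) (Function.onFun Nat.Coprime id) :=
      fun p hp r hr hpr => (Nat.coprime_primes (Nat.prime_of_mem_primeFactors hp)
        (Nat.prime_of_mem_primeFactors hr)).2 hpr
    obtain ⟨x, hx⟩ := Nat.chineseRemainderOfFinset X id N.primeFactors hne hco
    obtain ⟨y, hy⟩ := Nat.chineseRemainderOfFinset Y id N.primeFactors hne hco
    refine ⟨x, y, Int.isCoprime_iff_gcd_eq_one.2 ?_⟩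
    by_contra hg
    obtain ⟨p, hp, hpd⟩ := Nat.exists_prime_and_dvd hg
    rw [Int.gcd, Nat.dvd_gcd_iff, Int.natAbs_natCast] at hpd
    have hm : p ∈ N.primeFactors := Nat.mem_primeFactors.2 ⟨hp, hpd.2, hN⟩
    refine hXY p hp ?_
    have hx' : (x : ℤ) ≡ X p [ZMOD p] := Int.natCast_modEq_iff.2 (hx p hm)
    have hy' : (y : ℤ) ≡ Y p [ZMOD p] := Int.natCast_modEq_iff.2 (hy p hm)
    have e : q.eval x y ≡ q.eval (X p) (Y p) [ZMOD p] :=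
      (((hx'.pow 2).mul_left _).add ((hx'.mul_left _).mul hy')).add ((hy'.pow 2).mul_left _)
    exact e.dvd_iff.1 (Int.natCast_dvd.2 hpd.1)
  by_cases hxy : x = 0 ∧ y = 0
  · obtain ⟨rfl, rfl⟩ := hxy
    have h' : IsCoprime (0 : ℤ) N := by simpa [eval] using h
    obtain ⟨u, t, hut⟩ := h'
    exact ⟨1, 0, isCoprime_one_left, 0, t, by linear_combination hut⟩
  · have hpos : 0 < x.gcd y := Int.gcd_pos_iff.2 (by tauto)
    obtain ⟨x', y', hco, hx, hy⟩ := Int.exists_gcd_one hpos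
    refine ⟨x', y', Int.isCoprime_iff_gcd_eq_one.2 hco, h.of_isCoprime_of_dvd_left ?_⟩
    generalize x.gcd y = d at hx hy
    subst hx hy
    refine ⟨(d : ℤ) ^ 2, ?_⟩
    simp only [eval]; ring

theorem exists_content_smul (q : IBQF) (hq : q.content ≠ 0) :
    ∃ r : IBQF, r.content = 1 ∧ q = ⟨q.content * r.a, q.content * r.b, q.content * r.c⟩ := by
  obtain ⟨⟨a, ha⟩, ⟨b, hb⟩, ⟨c, hc⟩⟩ := (q.dvd_content_iff q.content).1 dvd_rfl
  refine ⟨⟨a, b, c⟩, ?_, IBQF.ext ha hb hc⟩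
  refine Nat.eq_of_mul_eq_mul_left (Nat.pos_of_ne_zero hq) ?_
  calc q.content * content ⟨a, b, c⟩ = content ⟨q.content * a, q.content * b, q.content * c⟩ := by
        simp only [content, Int.natAbs_mul, Int.natAbs_natCast, Nat.gcd_mul_left]
    _ = q.content * 1 := by rw [← ha, ← hb, ← hc, mul_one]

theorem content_ne_zero {q : IBQF} (hq : q.disc ≠ 0) : q.content ≠ 0 := by
  intro h
  obtain ⟨-, hb, hc⟩ := (q.dvd_content_iff q.content).1 dvd_rfl
  rw [h, Nat.cast_zero, zero_dvd_iff] at hb hc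
  simp [disc, hb, hc] at hq

end IBQF

namespace FormClass

theorem exists_mk_isCoprime (s : FormClass) (hs : s.content ≠ 0) (N : ℕ) (hN : N ≠ 0) :
    ∃ α b c : ℤ, s = mk ⟨s.content * α, b, c⟩ ∧ IsCoprime α N := by
  obtain ⟨q, rfl⟩ := s.exists_mk
  obtain ⟨r, hr, e⟩ := q.exists_content_smul hs
  obtain ⟨x, y, ⟨u, t, hut⟩, h⟩ := r.exists_isCoprime_eval hr N hN
  refine ⟨r.eval x y, _, _, mk_eq_mk.2 ⟨!![x, -t; y, u], ?_, IBQF.ext ?_ rfl rfl⟩, h⟩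
  · rw [Matrix.det_fin_two_of]; linarith
  · rw [content_mk]
    generalize q.content = m at *
    subst e
    simp [IBQF.comp, IBQF.eval]; ring

/-- Classes of the same nonzero discriminant with coprime contents have concordant
representatives. -/
theorem exists_concordant {s₁ s₂ : FormClass} (hD : s₁.disc = s₂.disc) (h0 : s₂.disc ≠ 0)
    (hc : Nat.Coprime s₁.content s₂.content) :
    ∃ a₁ a₂ b c : ℤ, IsCoprime a₁ a₂ ∧ s₁ = mk ⟨a₁, b, a₂ * c⟩ ∧ s₂ = mk ⟨a₂, b, a₁ * c⟩ := by
  have hm₁ : s₁.content ≠ 0 := by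
    obtain ⟨q, rfl⟩ := s₁.exists_mk
    exact IBQF.content_ne_zero (hD.trans_ne h0)
  have hm₂ : s₂.content ≠ 0 := by
    obtain ⟨q, rfl⟩ := s₂.exists_mk
    exact IBQF.content_ne_zero h0
  obtain ⟨α₁, b₁, c₁, h₁, hα₁⟩ := s₁.exists_mk_isCoprime hm₁ (2 * s₂.content) (by simpa using hm₂)
  push_cast at hα₁
  have hα₁0 : α₁ ≠ 0 := by
    rintro rfl
    have h2 := isUnit_of_mul_isUnit_left (isCoprime_zero_left.1 hα₁)
    exact absurd (Int.isUnit_iff.1 h2) (by norm_num)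
  have ha₁ : (s₁.content : ℤ) * α₁ ≠ 0 := mul_ne_zero (by exact_mod_cast hm₁) hα₁0
  obtain ⟨α₂, b₂, c₂, h₂, hα₂⟩ := s₂.exists_mk_isCoprime hm₂ (s₁.content * α₁).natAbs
    (Int.natAbs_ne_zero.2 ha₁)
  have hco : IsCoprime ((s₁.content : ℤ) * α₁) (s₂.content * α₂) := by
    refine IsCoprime.mul_right (IsCoprime.mul_left ?_ hα₁.of_mul_right_right) ?_
    · exact Nat.isCoprime_iff_coprime.2 hc
    · rw [Int.natCast_natAbs] at hα₂
      exact (IsCoprime.abs_right_iff _ _ |>.1 hα₂).symm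
  generalize (s₁.content : ℤ) * α₁ = a₁ at *
  generalize (s₂.content : ℤ) * α₂ = a₂ at *
  rw [h₁, h₂, disc_mk, disc_mk, IBQF.disc, IBQF.disc] at hD
  dsimp only at hD
  obtain ⟨e, he⟩ : (2 : ℤ) ∣ b₁ - b₂ := by
    have hev : Even (b₁ ^ 2 - b₂ ^ 2) := ⟨2 * (a₁ * c₁ - a₂ * c₂), by linarith⟩
    rw [Int.even_sub, Int.even_pow' two_ne_zero, Int.even_pow' two_ne_zero, ← Int.even_sub] at hev
    exact hev.two_dvd
  obtain ⟨u, t, hut⟩ := hco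
  rw [mk_shift _ _ _ (-(u * e))] at h₁
  rw [mk_shift _ _ _ (t * e)] at h₂
  have hb : b₂ + 2 * a₂ * (t * e) = b₁ + 2 * a₁ * -(u * e) := by
    linear_combination 2 * e * hut - he
  rw [hb] at h₂
  set k₁ := a₁ * (-(u * e)) ^ 2 + b₁ * -(u * e) + c₁ with hk₁
  set k₂ := a₂ * (t * e) ^ 2 + b₂ * (t * e) + c₂ with hk₂
  have hk : a₁ * k₁ = a₂ * k₂ := by
    have h4 : 4 * (a₁ * k₁) = 4 * (a₂ * k₂) := by
      rw [hk₁, hk₂]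
      linear_combination -hD - (b₂ + 2 * a₂ * (t * e) + (b₁ + 2 * a₁ * -(u * e))) * hb
    linarith
  obtain ⟨c, hc₂⟩ : a₁ ∣ k₂ := IsCoprime.dvd_of_dvd_mul_left ⟨u, t, hut⟩ ⟨k₁, hk.symm⟩
  have hk' : k₁ = a₂ * c := mul_left_cancel₀ ha₁ (by rw [hk, hc₂]; ring)
  rw [hk'] at h₁
  rw [hc₂] at h₂
  exact ⟨a₁, a₂, _, c, ⟨u, t, hut⟩, h₁, h₂⟩

theorem content_concordant {a₁ a₂ b c : ℤ} (h : IsCoprime a₁ a₂) :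
    (mk ⟨a₁ * a₂, b, c⟩).content =
      (mk ⟨a₁, b, a₂ * c⟩).content * (mk ⟨a₂, b, a₁ * c⟩).content := by
  have h' : Nat.Coprime a₁.natAbs a₂.natAbs := Int.isCoprime_iff_gcd_eq_one.1 h
  have key : ∀ k l m n : ℕ, Nat.Coprime k l →
      Nat.gcd k (Nat.gcd m (l * n)) = Nat.gcd k (Nat.gcd m n) := by
    intro k l m n hkl
    rw [Nat.gcd_left_comm, hkl.symm.gcd_mul_left_cancel_right, Nat.gcd_left_comm]
  simp only [content_mk, IBQF.content, Int.natAbs_mul]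
  rw [key _ _ _ _ h', key _ _ _ _ h'.symm, Nat.gcd_comm, h'.gcd_mul, Nat.gcd_comm,
    Nat.gcd_comm a₂.natAbs]

theorem isInverse_bar {s : FormClass} (hs : s.IsPrimitive) : s.bar.IsInverse s := by
  have hb : s.bar.IsPrimitive := (content_bar s).trans hs
  refine ⟨hb, ?_⟩
  obtain ⟨⟨a, b, c⟩, rfl⟩ := s.exists_mk
  have e₁ : (mk ⟨a, b, c⟩).bar = mk ⟨c, b, a * 1⟩ := by
    rw [bar_mk, IBQF.bar, mk_swap, neg_neg, mul_one]
  have e₂ : mk ⟨a, b, c⟩ = mk ⟨a, b, c * 1⟩ := by rw [mul_one]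
  have e₃ : mk (IBQF.principal (mk ⟨a, b, c⟩).disc) = mk ⟨c * a, b, 1⟩ := by
    rw [mk_swap (c * a), disc_mk]
    set D := IBQF.disc ⟨a, b, c⟩ with hD
    have hD' : D = b ^ 2 - 4 * a * c := hD
    have hpar : (2 : ℤ) ∣ D % 2 + b := by
      have : (D + b) % 2 = 0 := by
        rw [hD', show b ^ 2 - 4 * a * c + b = b * (b + 1) + 2 * (-(2 * a * c)) by ring,
          Int.add_mul_emod_self_left]
        exact Int.even_iff.1 (Int.even_mul_succ_self b)
      omega
    obtain ⟨k, hk⟩ := hpar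
    rw [mk_shift 1 (-b) _ k, IBQF.principal]
    congr 2
    · linarith
    · have hr : D % 2 * (D % 2) = D % 2 := by
        rcases Int.emod_two_eq_zero_or_one D with h | h <;> rw [h] <;> norm_num
      refine Int.ediv_eq_of_eq_mul_right (by norm_num) ?_
      have hm : D % 2 = 2 * k - b := by linarith
      calc D % 2 - D = D % 2 * (D % 2) - D := by rw [hr]
        _ = _ := by rw [hm, hD']; ring
  have hco : Nat.Coprime (mk ⟨a, b, c⟩).bar.content (mk ⟨a, b, c⟩).content := by
    rw [hs]; exact Nat.coprime_one_right _
  rw [e₃]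
  rw [e₁, e₂] at hco ⊢
  exact isComposition_concordant hco

end FormClass

theorem mk_kleinForm_eq_of_det_eq_one {v w : Matrix (Fin 2) (Fin 2) ℤ} (hv : v.det = 1) :
    FormClass.mk (kleinForm₁ v w) = FormClass.mk (kleinForm₂ v w) := by
  refine FormClass.mk_eq_mk.2 ⟨grossConj v.adjugate, ?_, ?_⟩
  · rw [det_grossConj, Matrix.det_adjugate, hv, one_pow]
  · have e : v.adjugate * v = 1 := by rw [Matrix.adjugate_mul, hv, one_smul]
    have e' : v.adjugate.adjugate = v := by
      ext i j
      fin_cases i <;> fin_cases j <;> simp [Matrix.adjugate_fin_two]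
    rw [kleinForm₁, kleinForm₂, ← grossForm_grossPart_conj, grossConj_grossConj, e',
      ← Matrix.mul_assoc, e, Matrix.one_mul]

theorem FormClass.IsInverse.eq_bar {t s : FormClass} (h : t.IsInverse s) : t = s.bar := by
  obtain ⟨-, -, ⟨a₁, a₂, b, c, ht, hs⟩, heq⟩ := h
  obtain ⟨g, hg, e⟩ := mk_eq_mk.1 (heq _ _ _ _ ht hs).symm
  rw [← pairForm_concordant, ← pairForm_baseChange] at e
  have hv := congrArg IBQF.a e.symm
  have h := mk_kleinForm_eq_of_det_eq_one (w := g 0 1 • !![a₁, 0; b, a₂] + g 1 1 • !![0, -1; c, 0]) hv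
  rw [kleinForm₁_baseChange _ _ _ hg, kleinForm₂_baseChange _ _ _ hg, kleinForm₁_concordant,
    kleinForm₂_concordant, ← hs, ← bar_mk, ← ht] at h
  rw [← h, bar_bar]

/-! ### Primitivity of a plane -/

theorem dvd_of_smul_eq {M : Type*} [AddCommGroup M] {P N : Submodule ℤ M} (hN : IsCompl P N)
    (v : Module.Basis (Fin 2) ℤ P) {p x y : ℤ} {u : M}
    (h : p • u = x • (v 0 : M) + y • (v 1 : M)) : p ∣ x ∧ p ∣ y := by
  have e : (p • Submodule.projectionOnto P N hN u : P) = x • v 0 + y • v 1 := by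
    rw [← map_smul, h]
    simp [-zsmul_eq_mul]
  have hr := congrArg v.repr e
  have h0 := DFunLike.congr_fun hr 0
  have h1 := DFunLike.congr_fun hr 1
  simp [-zsmul_eq_mul] at h0 h1
  exact ⟨⟨_, h0.symm⟩, ⟨_, h1.symm⟩⟩

theorem not_forall_dvd_minors {P N : Submodule ℤ (Matrix (Fin 2) (Fin 2) ℤ)} (hN : IsCompl P N)
    (v : Module.Basis (Fin 2) ℤ P) {p : ℕ} (hp : p.Prime)
    (h : ∀ i j k l, (p : ℤ) ∣ (v 0).1 i j * (v 1).1 k l - (v 0).1 k l * (v 1).1 i j) : False := by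
  have hdiv : ∀ x y : ℤ, (∀ i j, (p : ℤ) ∣ x * (v 0).1 i j + y * (v 1).1 i j) →
      (p : ℤ) ∣ x ∧ (p : ℤ) ∣ y := by
    intro x y hxy
    choose u hu using hxy
    refine dvd_of_smul_eq hN v (u := Matrix.of u) ?_
    ext i j
    simpa [-zsmul_eq_mul] using (hu i j).symm
  by_cases h0 : ∀ i j, (p : ℤ) ∣ (v 0).1 i j
  · have := (hdiv 1 0 (by simpa using h0)).1
    exact hp.one_lt.ne' (by exact_mod_cast Int.eq_one_of_dvd_one (by positivity) this)
  · push Not at h0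
    obtain ⟨k, l, hkl⟩ := h0
    refine hkl (dvd_neg.1 (hdiv ((v 1).1 k l) (-(v 0).1 k l) fun i j => ?_).2)
    convert h i j k l using 1
    ring

theorem coprime_content_klein {v w : Matrix (Fin 2) (Fin 2) ℤ}
    (h : ∀ p : ℕ, p.Prime →
      ¬ ∀ i j k l, (p : ℤ) ∣ v i j * w k l - v k l * w i j) :
    Nat.Coprime (kleinForm₁ v w).content (kleinForm₂ v w).content := by
  refine Nat.coprime_of_dvd fun p hp h₁ h₂ => h p hp ?_
  rw [IBQF.dvd_content_iff, kleinForm₁_eq] at h₁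
  rw [IBQF.dvd_content_iff, kleinForm₂_eq] at h₂
  obtain ⟨h01, hm, h23⟩ := h₁
  obtain ⟨h13, hs, h02⟩ := h₂
  dsimp only at h01 hm h23 h13 hs h02
  have hprod : (p : ℤ) ∣ (v 0 0 * w 1 1 - v 1 1 * w 0 0) * (v 0 1 * w 1 0 - v 1 0 * w 0 1) := by
    have e : (v 0 0 * w 1 1 - v 1 1 * w 0 0) * (v 0 1 * w 1 0 - v 1 0 * w 0 1) =
        (v 0 0 * w 1 0 - v 1 0 * w 0 0) * (v 0 1 * w 1 1 - v 1 1 * w 0 1) -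
        (-(v 0 0 * w 0 1 - v 0 1 * w 0 0)) * (-(v 1 0 * w 1 1 - v 1 1 * w 1 0)) := by ring
    rw [e]; exact (h02.mul_right _).sub (h01.mul_right _)
  obtain ⟨h03, h12⟩ : (p : ℤ) ∣ v 0 0 * w 1 1 - v 1 1 * w 0 0 ∧
      (p : ℤ) ∣ v 0 1 * w 1 0 - v 1 0 * w 0 1 := by
    rcases (Nat.prime_iff_prime_int.1 hp).dvd_or_dvd hprod with h | h
    · exact ⟨h, (dvd_add_right h).1 hs⟩
    · exact ⟨(dvd_add_left h).1 hs, h⟩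
  have hdiag : ∀ i j, (p : ℤ) ∣ v i j * w i j - v i j * w i j := by simp
  have hsymm : ∀ {i j k l}, (p : ℤ) ∣ v i j * w k l - v k l * w i j →
      (p : ℤ) ∣ v k l * w i j - v i j * w k l := fun h => (dvd_sub_comm).1 h
  rw [dvd_neg] at h01 h23
  intro i j k l
  fin_cases i <;> fin_cases j <;> fin_cases k <;> fin_cases l <;>
    first
    | exact hdiag _ _ | exact h01 | exact h02 | exact h03 | exact h12 | exact h13 | exact h23
    | exact hsymm h01 | exact hsymm h02 | exact hsymm h03 | exact hsymm h12 | exact hsymm h13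
    | exact hsymm h23

theorem dvd_content_grossForm_smul (p : ℕ) (B : grossLattice) :
    p ∣ (grossForm ((p : ℤ) • B)).content := by
  obtain ⟨q, rfl⟩ := grossEquiv.surjective B
  have e : (p : ℤ) • grossEquiv q = grossEquiv ⟨p * q.a, p * q.b, p * q.c⟩ := by
    apply Subtype.ext
    ext i j
    fin_cases i <;> fin_cases j <;> simp [-zsmul_eq_mul, grossEquiv] <;> ring
  rw [e, grossForm, Equiv.symm_apply_apply, IBQF.dvd_content_iff]
  simp

theorem pairPrimitive_of_coprime_content {A₁ A₂ : grossLattice}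
    (h : Nat.Coprime (grossForm A₁).content (grossForm A₂).content) : PairPrimitive A₁ A₂ := by
  rintro ⟨p, hp, B₁, B₂, rfl, rfl⟩
  exact Nat.not_coprime_of_dvd_of_dvd hp.one_lt (dvd_content_grossForm_smul p B₁)
    (dvd_content_grossForm_smul p B₂) h

theorem theorem1p3 (L : OrientedPlane) (hL : L.formClass.disc ≠ 0) :
    -- the Klein vectors of `L` are pair-primitive
    PairPrimitive L.klein₁ L.klein₂ ∧
    -- `[q_L]` is the composition of the orientation reversal of `[q_{a₁}]` with `[q_{a₂}]`
    FormClass.IsComposition L.kleinClass₁.bar L.kleinClass₂ L.formClass ∧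
    -- the contents multiply
    L.formClass.content = (grossForm L.klein₁).content * (grossForm L.klein₂).content ∧
    -- the primitive case, in the oriented class group
    ((grossForm L.klein₁).content = 1 → (grossForm L.klein₂).content = 1 →
      L.formClass.IsPrimitive ∧
      (∃! t : FormClass, t.IsInverse L.kleinClass₁) ∧
      ∀ t : FormClass, t.IsInverse L.kleinClass₁ →
        FormClass.IsComposition t L.kleinClass₂ L.formClass) := by
  obtain ⟨P, ⟨N, hN⟩, o⟩ := L
  obtain ⟨v, rfl⟩ := Quotient.exists_rep o
  set L : OrientedPlane := ⟨P, ⟨N, hN⟩, Quotient.mk _ v⟩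
  have hq : L.formClass = FormClass.mk (pairForm (v 0) (v 1)) := rfl
  have hk₁ : grossForm L.klein₁ = kleinForm₁ (v 0) (v 1) := rfl
  have hk₂ : grossForm L.klein₂ = kleinForm₂ (v 0) (v 1) := rfl
  have hc₁ : L.kleinClass₁ = FormClass.mk (kleinForm₁ (v 0) (v 1)) := rfl
  have hc₂ : L.kleinClass₂ = FormClass.mk (kleinForm₂ (v 0) (v 1)) := rfl
  have hco : Nat.Coprime (kleinForm₁ (v 0 : Matrix (Fin 2) (Fin 2) ℤ) (v 1)).content
      (kleinForm₂ (v 0 : Matrix (Fin 2) (Fin 2) ℤ) (v 1)).content :=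
    coprime_content_klein fun p hp h => not_forall_dvd_minors hN v hp h
  have hco' : Nat.Coprime L.kleinClass₁.bar.content L.kleinClass₂.content := by
    rw [FormClass.content_bar]; exact hco
  have hd₂ : L.kleinClass₂.disc = L.formClass.disc := disc_kleinForm₂ _ _
  have hd₁ : L.kleinClass₁.bar.disc = L.kleinClass₂.disc := by
    rw [FormClass.disc_bar, hd₂]; exact disc_kleinForm₁ _ _
  obtain ⟨a₁, a₂, b, c, ha, h₁, h₂⟩ := FormClass.exists_concordant hd₁ (hd₂.trans_ne hL) hco'
  have hform : L.formClass = FormClass.mk ⟨a₁ * a₂, b, c⟩ :=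
    FormClass.mk_pairForm_of_concordant hco h₁ h₂
  have hcomp : FormClass.IsComposition L.kleinClass₁.bar L.kleinClass₂ L.formClass := by
    rw [hform]
    rw [h₁, h₂] at hco' ⊢
    exact FormClass.isComposition_concordant hco'
  have hcont : L.formClass.content =
      (grossForm L.klein₁).content * (grossForm L.klein₂).content := by
    rw [hform, FormClass.content_concordant ha, ← h₁, ← h₂, FormClass.content_bar]
    rfl
  refine ⟨pairPrimitive_of_coprime_content hco, hcomp, hcont, fun hp₁ hp₂ => ⟨?_, ?_, ?_⟩⟩
  · rw [FormClass.IsPrimitive, hcont, hp₁, hp₂]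
  · exact ⟨_, FormClass.isInverse_bar hp₁, fun t ht => ht.eq_bar⟩
  · rintro t ht
    rw [ht.eq_bar]
    exact hcomp
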